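/- Hypercube-like networks are defined recursively: $K_2$ is the only $1$-dimensional hypercube-like network; and for $n\ge 2$, the $n$-dimensional hypercube-like networks are the graphs $Q^1\oplus_f Q^2$ obtained from two disjoint $(n-1)$-dimensional hypercube-like networks $Q^1,Q^2$ and a bijection $f:V(Q^1)\to V(Q^2)$ by adding to $Q^1\cup Q^2$ the edges $\{v,f(v)\}$ for all $v\in V(Q^1)$. A graph $G$ is called strongly Menger edge connected if it is connected and any two distinct vertices $u,v$ of $G$ are joined by $\min\{\deg_G(u),\deg_G(v)\}$ pairwise edge-disjoint paths. For an integer $m\ge 0$, $G$ is called $m$-edge-fault-tolerant strongly Menger edge connected if $G-F$ is strongly Menger edge connected for every $F\subseteq E(G)$ with $|F|\le m$. Theorem. Let $n\ge 2$ and let $L_n$ be the line graph of any $n$-dimensional hypercube-like network. Then $L_n$ is $(2n-4)$-edge-fault-tolerant strongly Menger edge connected. Moreover, for every integer $k>2n-4$, $L_n$ is not $k$-edge-fault-tolerant strongly Menger edge connected. -/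

import Mathlib

namespace SimpleGraph

/-- The graph `G₁ ⊕_f G₂`: the disjoint union of `G₁` and `G₂`, together with one new edge
joining `v` to `f v` for each vertex `v` of `G₁`. -/
def bijJoin {V₁ V₂ : Type*} (G₁ : SimpleGraph V₁) (G₂ : SimpleGraph V₂) (f : V₁ ≃ V₂) :
    SimpleGraph (V₁ ⊕ V₂) where
  Adj x y :=
    match x, y with
    | Sum.inl a, Sum.inl b => G₁.Adj a b
    | Sum.inr a, Sum.inr b => G₂.Adj a b
    | Sum.inl a, Sum.inr b => f a = b
    | Sum.inr b, Sum.inl a => f a = b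
  symm.symm := by
    rintro (a | a) (b | b) h
    · exact G₁.adj_symm h
    · exact h
    · exact h
    · exact G₂.adj_symm h
  loopless.irrefl := by
    rintro (a | a) h
    · exact G₁.irrefl h
    · exact G₂.irrefl h

universe u

/-- `IsHypercubeLike n G`: up to isomorphism, `G` is an `n`-dimensional hypercube-like network.
There is none of dimension `0`. -/
inductive IsHypercubeLike : ℕ → ∀ {V : Type u}, SimpleGraph V → Prop
  | base {V : Type u} (G : SimpleGraph V) (e : G ≃g completeGraph (Fin 2)) :
      IsHypercubeLike 1 G
  | step {n : ℕ} {V₁ V₂ V : Type u} (G₁ : SimpleGraph V₁) (G₂ : SimpleGraph V₂)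
      (h₁ : IsHypercubeLike n G₁) (h₂ : IsHypercubeLike n G₂) (f : V₁ ≃ V₂)
      (G : SimpleGraph V) (e : G ≃g bijJoin G₁ G₂ f) :
      IsHypercubeLike (n + 1) G

/-- There are (at least) `k` pairwise edge-disjoint paths from `u` to `v` in `G`. For `u ≠ v` the
paths of such a family are automatically pairwise distinct. -/
def HasEdgeDisjointPaths {V : Type*} (G : SimpleGraph V) (k : ℕ) (u v : V) : Prop :=
  ∃ P : Fin k → G.Path u v, ∀ i j : Fin k, i ≠ j →
    List.Disjoint (P i : G.Walk u v).edges (P j : G.Walk u v).edges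

/-- A (finite) graph is strongly Menger edge connected if it is connected and any two distinct
vertices are joined by as many edge-disjoint paths as the smaller of their degrees. -/
def StronglyMengerEdgeConnected {V : Type*} (G : SimpleGraph V) : Prop :=
  G.Connected ∧ ∀ u v : V, u ≠ v →
    G.HasEdgeDisjointPaths (min (G.neighborSet u).ncard (G.neighborSet v).ncard) u v

/-- `G` stays strongly Menger edge connected after deleting any at most `m` of its edges. -/
def EdgeFaultTolerantSMEC {V : Type*} (m : ℕ) (G : SimpleGraph V) : Prop :=
  ∀ F : Finset (Sym2 V), (F : Set (Sym2 V)) ⊆ G.edgeSet → F.card ≤ m →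
    (G.deleteEdges (F : Set (Sym2 V))).StronglyMengerEdgeConnected

end SimpleGraph

/-! By induction along the recursive construction, a hypercube-like network `Q` of dimension `n` is
`n`-regular, triangle-free and stays connected after losing fewer than `n` vertices (`IsNetwork`).
Nothing else about `Q` is used besides its order `2 ^ n`. Its line graph is `(2n-2)`-regular, and an
edge cut of it is a set of pairs of edges of `Q` that meet at a vertex and lie in different classes
of a bipartition of the edges. If both classes have at least two edges, there are at least `4n-6`
such pairs (`IsNetwork.le_mixedPairs`). After at most `2n-4` faults such a cut retains `2n-2` edges,
which no degree exceeds, so only a cut around a single vertex can be smaller. Menger's theorem,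
proved by augmenting integral flows, then yields the paths. For sharpness, `2n-3` faults turn one
vertex into a pendant one: its neighbour keeps full degree but has one useless edge. -/

namespace SimpleGraph

/-! ### Edge version of Menger's theorem, via unit flows -/

section Flow

open Finset

variable {W : Type*}

/-- An integral flow on `G` with unit capacities, as an antisymmetric function on ordered pairs. -/
structure IsUnitFlow (G : SimpleGraph W) (φ : W → W → ℤ) : Prop where
  antisymm : ∀ x y, φ x y = -φ y x
  le_one : ∀ x y, φ x y ≤ 1
  eq_zero : ∀ x y, ¬ G.Adj x y → φ x y = 0

open Classical in
/-- The unit flow along the ordered pair `(a, b)`. -/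
noncomputable def pairFlow (a b x y : W) : ℤ :=
  (if x = a ∧ y = b then 1 else 0) - (if x = b ∧ y = a then 1 else 0)

lemma IsUnitFlow.add_pairFlow {G : SimpleGraph W} {φ : W → W → ℤ} (hφ : G.IsUnitFlow φ) {a b : W}
    (hab : G.Adj a b) (h : φ a b ≤ 0) :
    G.IsUnitFlow (fun x y => φ x y + pairFlow a b x y) where
  antisymm x y := by
    have := hφ.antisymm x y
    simp only [pairFlow]
    split_ifs <;> first | omega | (exfalso; tauto)
  le_one x y := by
    have := hφ.le_one x y
    simp only [pairFlow]
    split_ifs with h1 h2 h2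
    · omega
    · rw [h1.1, h1.2]
      omega
    · omega
    · omega
  eq_zero x y hxy := by
    have := hφ.eq_zero x y hxy
    have h1 : ¬ (x = a ∧ y = b) := by rintro ⟨rfl, rfl⟩; exact hxy hab
    have h2 : ¬ (x = b ∧ y = a) := by rintro ⟨rfl, rfl⟩; exact hxy hab.symm
    simp [pairFlow, this, h1, h2]

variable [Fintype W]

open Classical in
lemma sum_pairFlow (a b x : W) :
    ∑ y, pairFlow a b x y = (if x = a then 1 else 0) - (if x = b then 1 else 0) := by
  simp only [pairFlow, Finset.sum_sub_distrib]
  congr 1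
  · by_cases h : x = a <;> simp [h]
  · by_cases h : x = b <;> simp [h]

open Classical in
/-- Augmentation along a residual path. -/
lemma IsUnitFlow.exists_augment {G : SimpleGraph W} {u v : W} (p : G.Walk u v) (hp : p.IsPath)
    {φ : W → W → ℤ} (hφ : G.IsUnitFlow φ) (h : ∀ d ∈ p.darts, φ d.fst d.snd ≤ 0) :
    ∃ ψ, G.IsUnitFlow ψ ∧ ∀ x, ∑ y, ψ x y =
      ∑ y, φ x y + ((if x = u then 1 else 0) - (if x = v then 1 else 0)) := by
  induction p generalizing φ with
  | nil => exact ⟨φ, hφ, by simp⟩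
  | @cons u w v huw p ih =>
    rw [Walk.cons_isPath_iff] at hp
    have huw' : φ u w ≤ 0 := h ⟨(u, w), huw⟩ (by simp)
    -- A path does not return to `u`, so changing the flow on `u w` leaves the values on the
    -- remaining darts intact.
    obtain ⟨ψ, hψ, hdiv⟩ := ih hp.1 (hφ.add_pairFlow huw huw') (by
      intro d hd
      have h1 : d.fst ≠ u := by
        rintro rfl; exact hp.2 (p.dart_fst_mem_support_of_mem_darts hd)
      have h2 : d.snd ≠ u := by
        rintro rfl; exact hp.2 (p.dart_snd_mem_support_of_mem_darts hd)
      have := h d (by simp [hd])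
      simpa [pairFlow, h1, h2] using this)
    refine ⟨ψ, hψ, fun x => ?_⟩
    rw [hdiv x, Finset.sum_add_distrib, sum_pairFlow]
    ring

open Classical in
/-- Removal of a path carrying flow. -/
lemma IsUnitFlow.exists_remove {G : SimpleGraph W} {u v : W} (p : G.Walk u v) (hp : p.IsPath)
    {φ : W → W → ℤ} (hφ : G.IsUnitFlow φ) (h : ∀ d ∈ p.darts, φ d.fst d.snd = 1) :
    ∃ ψ, G.IsUnitFlow ψ ∧ (∀ x, ∑ y, ψ x y =
      ∑ y, φ x y - ((if x = u then 1 else 0) - (if x = v then 1 else 0))) ∧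
      (∀ x y, ψ x y = φ x y ∨ ψ x y = 0) ∧ (∀ d ∈ p.darts, ψ d.fst d.snd = 0) := by
  induction p generalizing φ with
  | nil => exact ⟨φ, hφ, by simp⟩
  | @cons u w v huw p ih =>
    rw [Walk.cons_isPath_iff] at hp
    have huw' : φ u w = 1 := h ⟨(u, w), huw⟩ (by simp)
    have hwu : φ w u = -1 := by rw [hφ.antisymm, huw']
    have hne := huw.ne
    -- Flow is removed from `u w` by pushing a unit along the reversed pair.
    obtain ⟨ψ, hψ, hdiv, hor, hz⟩ := ih hp.1 (hφ.add_pairFlow huw.symm (by omega)) (by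
      intro d hd
      have h1 : d.fst ≠ u := by
        rintro rfl; exact hp.2 (p.dart_fst_mem_support_of_mem_darts hd)
      have h2 : d.snd ≠ u := by
        rintro rfl; exact hp.2 (p.dart_snd_mem_support_of_mem_darts hd)
      have := h d (by simp [hd])
      simpa [pairFlow, h1, h2] using this)
    have hor' : ∀ x y, ψ x y = φ x y ∨ ψ x y = 0 := by
      intro x y
      rcases hor x y with h0 | h0
      · rw [h0]
        simp only [pairFlow]
        split_ifs with h1 h2 h2
        · exact absurd (h1.1.symm.trans h2.1) hne.symm
        · obtain ⟨rfl, rfl⟩ := h1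
          right; omega
        · obtain ⟨rfl, rfl⟩ := h2
          right; omega
        · left; omega
      · exact Or.inr h0
    refine ⟨ψ, hψ, fun x => ?_, hor', ?_⟩
    · rw [hdiv x, Finset.sum_add_distrib, sum_pairFlow]
      ring
    · intro d hd
      rw [Walk.darts_cons, List.mem_cons] at hd
      rcases hd with rfl | hd
      · rcases hor u w with h0 | h0
        · simp only
          rw [h0]
          simp [pairFlow, hne, huw']
        · exact h0
      · exact hz d hd

-- By antisymmetry the flow between vertices of `X` cancels.
open Classical in
lemma IsUnitFlow.sum_div_eq {G : SimpleGraph W} {φ : W → W → ℤ} (hφ : G.IsUnitFlow φ)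
    (X : Finset W) : ∑ x ∈ X, ∑ y, φ x y = ∑ x ∈ X, ∑ y ∈ Xᶜ, φ x y := by
  have h0 : ∑ x ∈ X, ∑ y ∈ X, φ x y = 0 := by
    have h1 : ∑ x ∈ X, ∑ y ∈ X, φ x y = -∑ x ∈ X, ∑ y ∈ X, φ x y := by
      conv_lhs => rw [Finset.sum_comm]
      simp only [← Finset.sum_neg_distrib]
      exact Finset.sum_congr rfl fun x _ => Finset.sum_congr rfl fun y _ => hφ.antisymm y x
    omega
  have h2 : ∀ x, ∑ y, φ x y = ∑ y ∈ X, φ x y + ∑ y ∈ Xᶜ, φ x y := fun x =>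
    (Finset.sum_add_sum_compl X _).symm
  simp only [h2, Finset.sum_add_distrib, h0, zero_add]

open Classical in
/-- The vertices reachable from `u` by a walk all of whose darts satisfy `r`. -/
noncomputable def dartReach (G : SimpleGraph W) (r : W → W → Prop) (u : W) : Finset W :=
  univ.filter fun x => ∃ p : G.Walk u x, ∀ d ∈ p.darts, r d.fst d.snd

lemma self_mem_dartReach (G : SimpleGraph W) (r : W → W → Prop) (u : W) :
    u ∈ G.dartReach r u := by
  simp only [dartReach, mem_filter, mem_univ, true_and]
  exact ⟨Walk.nil, by simp⟩

lemma mem_dartReach_of_adj {G : SimpleGraph W} {r : W → W → Prop} {u x y : W}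
    (hx : x ∈ G.dartReach r u) (hxy : G.Adj x y) (h : r x y) : y ∈ G.dartReach r u := by
  simp only [dartReach, mem_filter, mem_univ, true_and] at hx ⊢
  obtain ⟨p, hp⟩ := hx
  refine ⟨p.concat hxy, fun d hd => ?_⟩
  rw [Walk.darts_concat, List.concat_eq_append, List.mem_append, List.mem_singleton] at hd
  rcases hd with hd | rfl
  · exact hp d hd
  · exact h

lemma exists_isPath_of_mem_dartReach {G : SimpleGraph W} {r : W → W → Prop} {u x : W}
    (hx : x ∈ G.dartReach r u) :
    ∃ p : G.Walk u x, p.IsPath ∧ ∀ d ∈ p.darts, r d.fst d.snd := by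
  classical
  simp only [dartReach, mem_filter, mem_univ, true_and] at hx
  obtain ⟨p, hp⟩ := hx
  exact ⟨p.bypass, p.bypass_isPath, fun d hd => hp d (p.darts_bypass_subset_darts hd)⟩

open Classical in
/-- The number of edges leaving the vertex set `X`. -/
noncomputable def cutSize (G : SimpleGraph W) (X : Finset W) : ℕ :=
  ((univ : Finset (W × W)).filter fun p => p.1 ∈ X ∧ p.2 ∉ X ∧ G.Adj p.1 p.2).card

open Classical in
lemma cutSize_eq_sum (G : SimpleGraph W) (X : Finset W) :
    (G.cutSize X : ℤ) = ∑ x ∈ X, ∑ y ∈ Xᶜ, if G.Adj x y then 1 else 0 := by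
  rw [← Finset.sum_product', ← Finset.sum_filter, cutSize, Finset.card_eq_sum_ones]
  push_cast
  refine Finset.sum_congr ?_ fun _ _ => rfl
  ext p
  simp [and_assoc]

-- Ford–Fulkerson, one unit at a time. Here `φ x y ≤ 0` means that the dart is not saturated. If `v`
-- is not residually reachable, every edge leaving the reachable set carries exactly one unit, so
-- that this cut has only `k` edges.
open Classical in
lemma exists_isUnitFlow {G : SimpleGraph W} {u v : W} (k : ℕ)
    (hcut : ∀ X : Finset W, u ∈ X → v ∉ X → k ≤ G.cutSize X) :
    ∃ φ, G.IsUnitFlow φ ∧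
      ∀ x, ∑ y, φ x y = k * ((if x = u then 1 else 0) - (if x = v then 1 else 0)) := by
  induction k with
  | zero => exact ⟨fun _ _ => 0, ⟨by simp, by simp, by simp⟩, by simp⟩
  | succ k ih =>
    obtain ⟨φ, hφ, hdiv⟩ := ih fun X hu hv => (Nat.le_succ k).trans (hcut X hu hv)
    set X := G.dartReach (fun x y => φ x y ≤ 0) u with hX
    have huX : u ∈ X := self_mem_dartReach _ _ _
    by_cases hv : v ∈ X
    · obtain ⟨p, hp, hd⟩ := exists_isPath_of_mem_dartReach hv
      obtain ⟨ψ, hψ, h⟩ := hφ.exists_augment p hp hd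
      refine ⟨ψ, hψ, fun x => ?_⟩
      rw [h, hdiv]
      push_cast
      ring
    · exfalso
      have h1 := hφ.sum_div_eq X
      have h2 : ∑ x ∈ X, ∑ y, φ x y = k := by
        simp only [hdiv, ← Finset.mul_sum, Finset.sum_sub_distrib, Finset.sum_ite_eq', huX, hv]
        simp
      have h3 : ∑ x ∈ X, ∑ y ∈ Xᶜ, φ x y = G.cutSize X := by
        rw [cutSize_eq_sum]
        refine Finset.sum_congr rfl fun x hx => Finset.sum_congr rfl fun y hy => ?_
        split_ifs with hxy
        · by_contra hne
          have := hφ.le_one x y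
          exact (Finset.mem_compl.1 hy) (mem_dartReach_of_adj hx hxy (by omega))
        · exact hφ.eq_zero x y hxy
      have := hcut X huX hv
      omega

-- A path along darts of flow one exists, since otherwise the reachable set would have no positive
-- outflow. It is stripped off; the remaining flow vanishes on its edges in both directions, so
-- later paths avoid them.
open Classical in
lemma IsUnitFlow.exists_paths {G : SimpleGraph W} {u v : W} (k : ℕ)
    {φ : W → W → ℤ} (hφ : G.IsUnitFlow φ)
    (hdiv : ∀ x, ∑ y, φ x y = k * ((if x = u then 1 else 0) - (if x = v then 1 else 0))) :
    ∃ P : Fin k → G.Path u v, (∀ i, ∀ d ∈ (P i : G.Walk u v).darts, φ d.fst d.snd = 1) ∧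
      ∀ i j : Fin k, i ≠ j →
        List.Disjoint (P i : G.Walk u v).edges (P j : G.Walk u v).edges := by
  induction k generalizing φ with
  | zero => exact ⟨Fin.elim0, fun i => i.elim0, fun i => i.elim0⟩
  | succ k ih =>
    set X := G.dartReach (fun x y => φ x y = 1) u with hX
    have huX : u ∈ X := self_mem_dartReach _ _ _
    by_cases hv : v ∈ X
    · obtain ⟨p, hp, hd⟩ := exists_isPath_of_mem_dartReach hv
      obtain ⟨ψ, hψ, h, hor, hz⟩ := hφ.exists_remove p hp hd
      obtain ⟨P, hP1, hP2⟩ := ih hψ (fun x => by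
        rw [h, hdiv]
        push_cast
        ring)
      have hdisj : ∀ i, List.Disjoint p.edges (P i : G.Walk u v).edges := by
        intro i e he he'
        obtain ⟨d, hdp, rfl⟩ := List.mem_map.1 he
        obtain ⟨d', hdp', hdd⟩ := List.mem_map.1 he'
        have e0 := hz d hdp
        have e1 := hP1 i d' hdp'
        rcases (dart_edge_eq_iff d' d).1 hdd with rfl | rfl
        · omega
        · have := hψ.antisymm d.snd d.fst
          simp at e1
          omega
      refine ⟨Fin.cons ⟨p, hp⟩ P, ?_, ?_⟩
      · intro i
        refine Fin.cases ?_ (fun i => ?_) i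
        · simpa using hd
        · intro d hd
          simp only [Fin.cons_succ] at hd
          have := hP1 i d hd
          rcases hor d.fst d.snd with h' | h' <;> omega
      · intro i j
        refine Fin.cases ?_ (fun i => ?_) i <;> refine Fin.cases ?_ (fun j => ?_) j
        · simp
        · intro _
          simpa using hdisj j
        · intro _
          simpa using (hdisj i).symm
        · intro hij
          simpa using hP2 i j (fun h => hij (by rw [h]))
    · exfalso
      have h1 := hφ.sum_div_eq X
      have h2 : ∑ x ∈ X, ∑ y, φ x y = ((k + 1 : ℕ) : ℤ) := by
        simp only [hdiv, ← Finset.mul_sum, Finset.sum_sub_distrib, Finset.sum_ite_eq', huX, hv]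
        simp
      have h3 : ∑ x ∈ X, ∑ y ∈ Xᶜ, φ x y ≤ 0 := by
        refine Finset.sum_nonpos fun x hx => Finset.sum_nonpos fun y hy => ?_
        by_contra hlt
        by_cases hxy : G.Adj x y
        · have := hφ.le_one x y
          exact (Finset.mem_compl.1 hy) (mem_dartReach_of_adj hx hxy (by omega))
        · exact hlt (hφ.eq_zero x y hxy).le
      omega

/-- Menger's theorem for edges. -/
theorem hasEdgeDisjointPaths_of_le_cutSize {G : SimpleGraph W} {u v : W} {k : ℕ}
    (hcut : ∀ X : Finset W, u ∈ X → v ∉ X → k ≤ G.cutSize X) :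
    G.HasEdgeDisjointPaths k u v := by
  obtain ⟨φ, hφ, hdiv⟩ := exists_isUnitFlow k hcut
  obtain ⟨P, -, hP⟩ := hφ.exists_paths k hdiv
  exact ⟨P, hP⟩

theorem preconnected_of_cutSize_pos {G : SimpleGraph W}
    (hcut : ∀ (X : Finset W) (u v : W), u ∈ X → v ∉ X → 0 < G.cutSize X) : G.Preconnected := by
  classical
  intro u v
  by_contra huv
  have := hcut (univ.filter fun x => G.Reachable u x) u v (by simp) (by simpa using huv)
  obtain ⟨p, hp⟩ := Finset.card_pos.1 this
  simp only [mem_filter, mem_univ, true_and] at hp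
  exact hp.2.1 (hp.1.trans hp.2.2.reachable)

end Flow

/-! ### Regularity, triangle-freeness and connectivity of hypercube-like networks -/

section HypercubeLike

/-- `G` stays connected after the deletion of fewer than `n` vertices: a vertex property that is
constant along the remaining edges is constant. -/
def SurvivesDeletion {V : Type*} (n : ℕ) (G : SimpleGraph V) : Prop :=
  ∀ (S : Set V) (P : V → Prop), S.ncard < n →
    (∀ x ∉ S, ∀ y ∉ S, G.Adj x y → (P x ↔ P y)) → ∀ x ∉ S, ∀ y ∉ S, (P x ↔ P y)

/-- The properties of `n`-dimensional hypercube-like networks on which edge connectivity of the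
line graph rests. -/
structure IsNetwork {V : Type*} (n : ℕ) (G : SimpleGraph V) : Prop where
  pos : 0 < n
  finite : Finite V
  card : Nat.card V = 2 ^ n
  degree : ∀ v, (G.neighborSet v).ncard = n
  triangleFree : ∀ x y z, G.Adj x y → G.Adj y z → ¬ G.Adj x z
  survives : G.SurvivesDeletion n

lemma IsNetwork.of_iso {V V' : Type*} {n : ℕ} {G : SimpleGraph V} {G' : SimpleGraph V'}
    (h : G'.IsNetwork n) (e : G ≃g G') : G.IsNetwork n where
  pos := h.pos
  finite := have := h.finite; Finite.of_equiv V' e.toEquiv.symm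
  card := (Nat.card_congr e.toEquiv).trans h.card
  degree v := by
    rw [← h.degree (e v), ← Nat.card_coe_set_eq, ← Nat.card_coe_set_eq]
    exact Nat.card_congr (e.mapNeighborSet v)
  triangleFree x y z hxy hyz hxz :=
    h.triangleFree (e x) (e y) (e z) (e.map_adj_iff.2 hxy) (e.map_adj_iff.2 hyz)
      (e.map_adj_iff.2 hxz)
  survives S P hS hP x hx y hy := by
    have := h.survives (e.symm ⁻¹' S) (fun v => P (e.symm v))
      (by rwa [← Set.ncard_preimage_of_injective_subset_range (f := e.symm) e.symm.injective (by
            rw [Set.range_eq_univ.2 e.symm.surjective]; exact Set.subset_univ S)] at hS)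
      (fun a ha b hb hab => hP _ ha _ hb (e.symm.map_adj_iff.2 hab))
      (e x) (by simpa using hx) (e y) (by simpa using hy)
    simpa using this

lemma isNetwork_completeGraph_fin_two : (completeGraph (Fin 2)).IsNetwork 1 where
  pos := one_pos
  finite := inferInstance
  card := by simp
  degree v := by
    rw [Set.ncard_eq_toFinset_card']
    revert v
    decide
  triangleFree := by decide
  survives S P hS hP x hx y hy := by
    by_cases hxy : x = y
    · rw [hxy]
    · exact hP x hx y hy hxy

/-- At most `n` vertices are deleted. Either both halves lose fewer than `n` and stay connected, or
one half is intact and every survivor of the other is joined to its partner there. -/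
lemma IsNetwork.survivesDeletion_bijJoin {V₁ V₂ : Type*} {n : ℕ} {G₁ : SimpleGraph V₁}
    {G₂ : SimpleGraph V₂} (h₁ : G₁.IsNetwork n) (h₂ : G₂.IsNetwork n) (f : V₁ ≃ V₂) :
    (bijJoin G₁ G₂ f).SurvivesDeletion (n + 1) := by
  intro S P hS hP
  have := h₁.finite
  have := h₂.finite
  set S₁ : Set V₁ := Sum.inl ⁻¹' S with hS₁
  set S₂ : Set V₂ := Sum.inr ⁻¹' S with hS₂
  have hcard : S₁.ncard + S₂.ncard = S.ncard := by
    have hS' : S = Sum.inl '' S₁ ∪ Sum.inr '' S₂ := by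
      ext (a | a) <;> simp [hS₁, hS₂]
    conv_rhs => rw [hS']
    rw [Set.ncard_union_eq, Set.ncard_image_of_injective _ Sum.inl_injective,
      Set.ncard_image_of_injective _ Sum.inr_injective]
    rw [Set.disjoint_left]
    rintro _ ⟨a, -, rfl⟩ ⟨b, -, h⟩
    cases h
  have hcross : ∀ a, Sum.inl a ∉ S → Sum.inr (f a) ∉ S → (P (Sum.inl a) ↔ P (Sum.inr (f a))) :=
    fun a ha hb => hP _ ha _ hb (by simp [bijJoin])
  have conn₁ : S₁.ncard < n → ∀ a, Sum.inl a ∉ S → ∀ b, Sum.inl b ∉ S →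
      (P (Sum.inl a) ↔ P (Sum.inl b)) := fun hlt a ha b hb =>
    h₁.survives S₁ (fun a => P (Sum.inl a)) hlt
      (fun x hx y hy hxy => hP _ hx _ hy hxy) a ha b hb
  have conn₂ : S₂.ncard < n → ∀ a, Sum.inr a ∉ S → ∀ b, Sum.inr b ∉ S →
      (P (Sum.inr a) ↔ P (Sum.inr b)) := fun hlt a ha b hb =>
    h₂.survives S₂ (fun a => P (Sum.inr a)) hlt
      (fun x hx y hy hxy => hP _ hx _ hy hxy) a ha b hb
  have key : (∀ a, Sum.inl a ∉ S → ∀ b, Sum.inr b ∉ S → (P (Sum.inl a) ↔ P (Sum.inr b))) →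
      (∃ a, Sum.inl a ∉ S) → (∃ b, Sum.inr b ∉ S) → ∀ x ∉ S, ∀ y ∉ S, (P x ↔ P y) := by
    rintro h ⟨a₀, ha₀⟩ ⟨b₀, hb₀⟩ (x | x) hx (y | y) hy
    · rw [h x hx b₀ hb₀, h y hy b₀ hb₀]
    · exact h x hx y hy
    · exact (h y hy x hx).symm
    · rw [← h a₀ ha₀ x hx, ← h a₀ ha₀ y hy]
  have hpos := h₁.pos
  have hn : n < 2 ^ n := Nat.lt_two_pow_self
  -- There are `2 ^ n > n` disjoint cross edges, so one of them survives.
  obtain ⟨a₀, ha₀, hb₀⟩ : ∃ a, Sum.inl a ∉ S ∧ Sum.inr (f a) ∉ S := by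
    by_contra! hcon
    have hcov : S₁ ∪ f ⁻¹' S₂ = Set.univ := by
      ext a
      by_cases ha : Sum.inl a ∈ S
      · simp [hS₁, ha]
      · simp [hS₂, hcon a ha]
    have h1 := Set.ncard_union_le S₁ (f ⁻¹' S₂)
    have h2 : (f ⁻¹' S₂).ncard = S₂.ncard :=
      Set.ncard_preimage_of_injective_subset_range f.injective (by
        rw [Set.range_eq_univ.2 f.surjective]; exact Set.subset_univ _)
    rw [hcov, Set.ncard_univ, h₁.card] at h1
    omega
  refine key (fun a ha b hb => ?_) ⟨a₀, ha₀⟩ ⟨_, hb₀⟩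
  by_cases hlt₁ : S₁.ncard < n
  · by_cases hlt₂ : S₂.ncard < n
    · rw [conn₁ hlt₁ a ha a₀ ha₀, hcross a₀ ha₀ hb₀, conn₂ hlt₂ _ hb₀ b hb]
    · have hempty : S₁ = ∅ := (Set.ncard_eq_zero (Set.toFinite _)).1 (by omega)
      have hb' : Sum.inl (f.symm b) ∉ S := fun hmem => by
        have : f.symm b ∈ S₁ := hmem
        simp [hempty] at this
      rw [conn₁ hlt₁ a ha _ hb', hcross _ hb' (by simpa using hb), f.apply_symm_apply]
  · by_cases hn0 : S₂.ncard < n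
    · have hempty : S₂ = ∅ := (Set.ncard_eq_zero (Set.toFinite _)).1 (by omega)
      have ha' : Sum.inr (f a) ∉ S := fun hmem => by
        have : f a ∈ S₂ := hmem
        simp [hempty] at this
      rw [hcross a ha ha', conn₂ hn0 _ ha' b hb]
    · omega

lemma IsNetwork.bijJoin {V₁ V₂ : Type*} {n : ℕ} {G₁ : SimpleGraph V₁}
    {G₂ : SimpleGraph V₂} (h₁ : G₁.IsNetwork n) (h₂ : G₂.IsNetwork n) (f : V₁ ≃ V₂) :
    (bijJoin G₁ G₂ f).IsNetwork (n + 1) where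
  pos := n.succ_pos
  finite := have := h₁.finite; have := h₂.finite; inferInstance
  card := by
    have := h₁.finite
    have := h₂.finite
    rw [Nat.card_sum, h₁.card, h₂.card]
    ring
  degree := by
    have := h₁.finite
    have := h₂.finite
    rintro (a | a)
    · have : (SimpleGraph.bijJoin G₁ G₂ f).neighborSet (Sum.inl a) =
          insert (Sum.inr (f a)) (Sum.inl '' G₁.neighborSet a) := by
        ext (b | b) <;> simp [SimpleGraph.bijJoin, eq_comm]
      rw [this, Set.ncard_insert_of_notMem (by simp),
        Set.ncard_image_of_injective _ Sum.inl_injective, h₁.degree]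
    · have : (SimpleGraph.bijJoin G₁ G₂ f).neighborSet (Sum.inr a) =
          insert (Sum.inl (f.symm a)) (Sum.inr '' G₂.neighborSet a) := by
        ext (b | b) <;> simp [SimpleGraph.bijJoin, Equiv.eq_symm_apply]
      rw [this, Set.ncard_insert_of_notMem (by simp),
        Set.ncard_image_of_injective _ Sum.inr_injective, h₂.degree]
  triangleFree := by
    rintro (x | x) (y | y) (z | z) hxy hyz hxz <;> simp only [SimpleGraph.bijJoin] at hxy hyz hxz
    · exact h₁.triangleFree x y z hxy hyz hxz
    · subst hyz
      exact hxy.ne (f.injective hxz)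
    · subst hxy
      exact hxz.ne (f.injective hyz.symm)
    · subst hxy
      exact hyz.ne hxz
    · subst hxy
      exact hyz.ne (f.injective hxz.symm)
    · subst hxy
      exact hxz.ne hyz
    · subst hxz
      exact hxy.ne hyz
    · exact h₂.triangleFree x y z hxy hyz hxz
  survives := h₁.survivesDeletion_bijJoin h₂ f

theorem IsHypercubeLike.isNetwork {V : Type*} {n : ℕ} {G : SimpleGraph V}
    (h : IsHypercubeLike n G) : G.IsNetwork n := by
  induction h with
  | base G e => exact isNetwork_completeGraph_fin_two.of_iso e
  | step G₁ G₂ _ _ f G e ih₁ ih₂ => exact (ih₁.bijJoin ih₂ f).of_iso e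

end HypercubeLike

/-! ### Mixed pairs in a bipartition of the edges of a network -/

section EdgeBipartition

open Finset

variable {V : Type*} [Fintype V]

open Classical in
/-- The neighbours of `v` along edges in `X`. -/
noncomputable def neighborsVia (Q : SimpleGraph V) (X : Set (Sym2 V)) (v : V) : Finset V :=
  univ.filter fun w => Q.Adj v w ∧ s(v, w) ∈ X

lemma mem_neighborsVia {Q : SimpleGraph V} {X : Set (Sym2 V)} {v w : V} :
    w ∈ Q.neighborsVia X v ↔ Q.Adj v w ∧ s(v, w) ∈ X := by
  simp [neighborsVia]

lemma mem_neighborsVia_comm {Q : SimpleGraph V} {X : Set (Sym2 V)} {v w : V} :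
    w ∈ Q.neighborsVia X v ↔ v ∈ Q.neighborsVia X w := by
  rw [mem_neighborsVia, mem_neighborsVia, Q.adj_comm, Sym2.eq_swap]

lemma IsNetwork.card_neighborsVia_add {n : ℕ} {Q : SimpleGraph V} (hQ : Q.IsNetwork n)
    (X : Set (Sym2 V)) (v : V) :
    (Q.neighborsVia X v).card + (Q.neighborsVia Xᶜ v).card = n := by
  classical
  rw [← hQ.degree v, ← card_union_of_disjoint, ← Set.ncard_coe_finset]
  · congr 1
    ext w
    simp only [coe_union, Set.mem_union, mem_coe, mem_neighborsVia, mem_neighborSet,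
      Set.mem_compl_iff]
    tauto
  · rw [Finset.disjoint_left]
    intro w h h'
    exact (mem_neighborsVia.1 h').2 (mem_neighborsVia.1 h).2

/-- The number of pairs of adjacent edges, one in `X` and the other outside of `X`. -/
noncomputable def mixedPairs (Q : SimpleGraph V) (X : Set (Sym2 V)) : ℕ :=
  ∑ v, (Q.neighborsVia X v).card * (Q.neighborsVia Xᶜ v).card

lemma mixedPairs_compl (Q : SimpleGraph V) (X : Set (Sym2 V)) :
    Q.mixedPairs Xᶜ = Q.mixedPairs X := by
  simp only [mixedPairs, compl_compl, mul_comm]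

/-- A vertex meeting both classes contributes `a * b` with `a + b = n` and `a, b ≥ 1`, hence at
least `n - 1`. -/
lemma IsNetwork.card_mul_le_mixedPairs {n : ℕ} {Q : SimpleGraph V} (hQ : Q.IsNetwork n)
    (X : Set (Sym2 V)) (T : Finset V)
    (hT : ∀ v ∈ T, (Q.neighborsVia X v).Nonempty ∧ (Q.neighborsVia Xᶜ v).Nonempty) :
    T.card * n ≤ Q.mixedPairs X + T.card := by
  have h1 : T.card * n ≤
      ∑ v ∈ T, ((Q.neighborsVia X v).card * (Q.neighborsVia Xᶜ v).card + 1) := by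
    rw [← smul_eq_mul]
    refine Finset.card_nsmul_le_sum _ _ _ fun v hv => ?_
    have h := hQ.card_neighborsVia_add X v
    have ha := Finset.card_pos.2 (hT v hv).1
    have hb := Finset.card_pos.2 (hT v hv).2
    obtain ⟨a, ha'⟩ := Nat.exists_eq_add_of_lt ha
    obtain ⟨b, hb'⟩ := Nat.exists_eq_add_of_lt hb
    rw [← h, ha', hb']
    nlinarith [Nat.zero_le (a * b)]
  have h2 : ∑ v ∈ T, (Q.neighborsVia X v).card * (Q.neighborsVia Xᶜ v).card ≤ Q.mixedPairs X :=
    Finset.sum_le_sum_of_subset (Finset.subset_univ T)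
  rw [Finset.sum_add_distrib] at h1
  simp at h1
  omega

/-- Triangle-freeness forces the edges in `X` to be exactly `xy` and `yz`. The three vertices
contribute `(n-1) + 2(n-2) + (n-1) = 4n-6`, the extremal case. -/
lemma IsNetwork.le_mixedPairs_of_path {n : ℕ} {Q : SimpleGraph V} (hQ : Q.IsNetwork n)
    {X : Set (Sym2 V)} {x y z : V} (hx : x ∈ Q.neighborsVia X y) (hz : z ∈ Q.neighborsVia X y)
    (hxz : x ≠ z) (h : ∀ v, (Q.neighborsVia X v).Nonempty → v = x ∨ v = y ∨ v = z) :
    4 * n ≤ Q.mixedPairs X + 6 := by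
  classical
  have hyx := (mem_neighborsVia.1 hx).1
  have hyz := (mem_neighborsVia.1 hz).1
  have cover : ∀ v w, w ∈ Q.neighborsVia X v → w = x ∨ w = y ∨ w = z := fun v w hw =>
    h w ⟨v, mem_neighborsVia_comm.1 hw⟩
  have ax : Q.neighborsVia X x = {y} := by
    ext w
    rw [mem_singleton]
    refine ⟨fun hw => ?_, fun hw => hw ▸ mem_neighborsVia_comm.1 hx⟩
    have hxw := (mem_neighborsVia.1 hw).1
    rcases cover _ _ hw with rfl | h' | rfl
    · exact absurd hxw (Q.irrefl)
    · exact h'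
    · exact absurd hyz (hQ.triangleFree _ _ _ hyx hxw)
  have az : Q.neighborsVia X z = {y} := by
    ext w
    rw [mem_singleton]
    refine ⟨fun hw => ?_, fun hw => hw ▸ mem_neighborsVia_comm.1 hz⟩
    have hzw := (mem_neighborsVia.1 hw).1
    rcases cover _ _ hw with rfl | h' | rfl
    · exact absurd hyx (hQ.triangleFree _ _ _ hyz hzw)
    · exact h'
    · exact absurd hzw (Q.irrefl)
  have ay : Q.neighborsVia X y = {x, z} := by
    ext w
    rw [mem_insert, mem_singleton]
    refine ⟨fun hw => ?_, fun hw => ?_⟩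
    · have hyw := (mem_neighborsVia.1 hw).1
      rcases cover _ _ hw with h' | rfl | h'
      · exact Or.inl h'
      · exact absurd hyw (Q.irrefl)
      · exact Or.inr h'
    · rcases hw with rfl | rfl
      · exact hx
      · exact hz
  have hle : ∑ v ∈ ({x, y, z} : Finset V),
      (Q.neighborsVia X v).card * (Q.neighborsVia Xᶜ v).card ≤ Q.mixedPairs X :=
    Finset.sum_le_sum_of_subset (Finset.subset_univ _)
  have bx := hQ.card_neighborsVia_add X x
  have bY := hQ.card_neighborsVia_add X y
  have bz := hQ.card_neighborsVia_add X z
  rw [Finset.sum_insert (by simp [hyx.ne.symm, hxz]), Finset.sum_insert (by simp [hyz.ne]),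
    Finset.sum_singleton] at hle
  rw [ax, card_singleton] at hle bx
  rw [az, card_singleton] at hle bz
  rw [ay, card_pair hxz] at hle bY
  omega

/-- If `X` touches four vertices, they already give `4(n-1)`. Otherwise two distinct edges of `X`
share an endpoint, and `X` touches only the three vertices of a path. -/
lemma IsNetwork.le_mixedPairs_of_forall_mixed {n : ℕ} {Q : SimpleGraph V} (hQ : Q.IsNetwork n)
    {X : Set (Sym2 V)} {e e' : Sym2 V} (he : e ∈ Q.edgeSet) (he' : e' ∈ Q.edgeSet)
    (heX : e ∈ X) (heX' : e' ∈ X) (hne : e ≠ e')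
    (hmix : ∀ v, (Q.neighborsVia X v).Nonempty → (Q.neighborsVia Xᶜ v).Nonempty) :
    4 * n ≤ Q.mixedPairs X + 6 := by
  classical
  set M : Finset V := univ.filter fun v => (Q.neighborsVia X v).Nonempty with hM
  have memM : ∀ v w, w ∈ Q.neighborsVia X v → v ∈ M := fun v w h => by
    simpa [hM] using ⟨w, h⟩
  by_cases hcard : 4 ≤ M.card
  · obtain ⟨T, hTM, hT⟩ := Finset.exists_subset_card_eq hcard
    have := hQ.card_mul_le_mixedPairs X T fun v hv => by
      have hv' : (Q.neighborsVia X v).Nonempty := (Finset.mem_filter.1 (hTM hv)).2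
      exact ⟨hv', hmix v hv'⟩
    rw [hT] at this
    omega
  · have path : ∀ x y z, x ∈ Q.neighborsVia X y → z ∈ Q.neighborsVia X y → x ≠ z →
        4 * n ≤ Q.mixedPairs X + 6 := by
      intro x y z hx hz hxz
      have hyx := (mem_neighborsVia.1 hx).1.ne
      have hyz := (mem_neighborsVia.1 hz).1.ne
      refine hQ.le_mixedPairs_of_path hx hz hxz fun v hv => ?_
      by_contra! hcon
      have hsub : ({v, x, y, z} : Finset V) ⊆ M := by
        intro w hw
        simp only [mem_insert, mem_singleton] at hw
        rcases hw with rfl | rfl | rfl | rfl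
        · simpa [hM] using hv
        · exact memM _ _ (mem_neighborsVia_comm.1 hx)
        · exact memM _ _ hx
        · exact memM _ _ (mem_neighborsVia_comm.1 hz)
      have := Finset.card_le_card hsub
      rw [card_insert_of_notMem (by simp [hcon]), card_insert_of_notMem (by simp [hyx.symm, hxz]),
        card_insert_of_notMem (by simp [hyz]), card_singleton] at this
      omega
    induction e with | _ x y
    induction e' with | _ z w
    have hy : y ∈ Q.neighborsVia X x := mem_neighborsVia.2 ⟨he, heX⟩
    have hw : w ∈ Q.neighborsVia X z := mem_neighborsVia.2 ⟨he', heX'⟩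
    have hx := mem_neighborsVia_comm.1 hy
    have hz := mem_neighborsVia_comm.1 hw
    have hxy := (mem_neighborsVia.1 hy).1.ne
    have hzw := (mem_neighborsVia.1 hw).1.ne
    by_cases hxz : x = z
    · subst hxz
      exact path y x w hy hw (by rintro rfl; exact hne rfl)
    by_cases hxw : x = w
    · subst hxw
      exact path y x z hy hz (by rintro rfl; exact hne Sym2.eq_swap)
    by_cases hyz : y = z
    · subst hyz
      exact path x y w hx hw hxw
    by_cases hyw : y = w
    · subst hyw
      exact path x y z hx hz hxz
    exfalso
    have hsub : ({x, y, z, w} : Finset V) ⊆ M := by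
      intro v hv
      simp only [mem_insert, mem_singleton] at hv
      rcases hv with rfl | rfl | rfl | rfl
      · exact memM _ _ hy
      · exact memM _ _ hx
      · exact memM _ _ hw
      · exact memM _ _ hz
    have := Finset.card_le_card hsub
    rw [card_insert_of_notMem (by simp [hxy, hxz, hxw]), card_insert_of_notMem (by simp [hyz, hyw]),
      card_insert_of_notMem (by simp [hzw]), card_singleton] at this
    omega

/-- A partition of the edges of a network into two classes with at least two edges each has at
least `4 * n - 6` mixed pairs of adjacent edges. -/
theorem IsNetwork.le_mixedPairs {n : ℕ} {Q : SimpleGraph V} (hQ : Q.IsNetwork n)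
    {X : Set (Sym2 V)} {e e' f f' : Sym2 V} (he : e ∈ Q.edgeSet) (he' : e' ∈ Q.edgeSet)
    (hf : f ∈ Q.edgeSet) (hf' : f' ∈ Q.edgeSet)
    (heX : e ∈ X) (heX' : e' ∈ X) (hfX : f ∉ X) (hfX' : f' ∉ X) (hee : e ≠ e') (hff : f ≠ f') :
    4 * n ≤ Q.mixedPairs X + 6 := by
  classical
  set M : Finset V := univ.filter fun v =>
    (Q.neighborsVia X v).Nonempty ∧ (Q.neighborsVia Xᶜ v).Nonempty with hM
  have memM : ∀ v, v ∈ M ↔ (Q.neighborsVia X v).Nonempty ∧ (Q.neighborsVia Xᶜ v).Nonempty :=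
    fun v => by simp [hM]
  by_cases hcard : n ≤ M.card
  · obtain ⟨T, hTM, hT⟩ := Finset.exists_subset_card_eq hcard
    have h := hQ.card_mul_le_mixedPairs X T fun v hv => (memM v).1 (hTM hv)
    rw [hT] at h
    -- This is `(n-2)(n-3) ≥ 0`: `n` mixed vertices give `n(n-1) ≥ 4n-6` pairs.
    have hq : 5 * n ≤ n * n + 6 := by
      rcases Nat.lt_or_ge n 3 with h3 | h3
      · interval_cases n <;> omega
      · obtain ⟨m, rfl⟩ := Nat.exists_eq_add_of_le h3
        nlinarith [Nat.zero_le (m * m)]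
    omega
  -- Fewer than `n` vertices are mixed. Without them `Q` is still connected, and adjacent unmixed
  -- vertices see the same class, so all unmixed vertices do. The other class touches mixed vertices
  -- only.
  · have hconn := hQ.survives (M : Set V) (fun v => (Q.neighborsVia X v).Nonempty)
      (by rw [Set.ncard_coe_finset]; omega) (by
        intro x hx y hy hxy
        rw [mem_coe, memM] at hx hy
        by_cases hX : s(x, y) ∈ X
        · have h1 : y ∈ Q.neighborsVia X x := mem_neighborsVia.2 ⟨hxy, hX⟩
          exact iff_of_true ⟨y, h1⟩ ⟨x, mem_neighborsVia_comm.1 h1⟩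
        · have h1 : y ∈ Q.neighborsVia Xᶜ x := mem_neighborsVia.2 ⟨hxy, hX⟩
          exact iff_of_false (fun h => hx ⟨h, y, h1⟩)
            (fun h => hy ⟨h, x, mem_neighborsVia_comm.1 h1⟩))
    by_cases hall : ∀ v, (Q.neighborsVia X v).Nonempty → (Q.neighborsVia Xᶜ v).Nonempty
    · exact hQ.le_mixedPairs_of_forall_mixed he he' heX heX' hee hall
    · push Not at hall
      obtain ⟨v₀, h₀, h₀'⟩ := hall
      rw [← mixedPairs_compl]
      refine hQ.le_mixedPairs_of_forall_mixed hf hf' hfX hfX' hff fun v hv => ?_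
      rw [compl_compl]
      by_contra hv'
      have := hconn v (by simp [memM, hv']) v₀ (by simp [memM, h₀'])
      exact hv' (this.2 h₀)

end EdgeBipartition

/-! ### Cut sizes under deletion of edges and for single vertices -/

section Cuts

open Finset

variable {W : Type*} [Fintype W]

-- Cut edges are counted as pairs oriented out of `X`, so each deleted edge accounts for at most one
-- of them.
open Classical in
lemma cutSize_le_deleteEdges_add (G : SimpleGraph W) (F : Finset (Sym2 W)) (X : Finset W) :
    G.cutSize X ≤ (G.deleteEdges (F : Set (Sym2 W))).cutSize X + F.card := by
  set A := (univ : Finset (W × W)).filter fun p => p.1 ∈ X ∧ p.2 ∉ X ∧ G.Adj p.1 p.2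
  set B := A.filter fun p => s(p.1, p.2) ∈ F with hB
  have h1 : A = ((univ : Finset (W × W)).filter fun p => p.1 ∈ X ∧ p.2 ∉ X ∧
      (G.deleteEdges (F : Set (Sym2 W))).Adj p.1 p.2) ∪ B := by
    ext p
    simp only [A, hB, mem_filter, mem_univ, true_and, mem_union, deleteEdges_adj, mem_coe]
    tauto
  have h2 : B.card ≤ F.card := by
    refine Finset.card_le_card_of_injOn (fun p => s(p.1, p.2))
      (fun p hp => (Finset.mem_filter.1 hp).2) ?_
    rintro ⟨a, b⟩ hp ⟨c, d⟩ hq h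
    simp only [A, hB, mem_filter, mem_univ, true_and, coe_filter, Set.mem_ofPred_eq] at hp hq
    rcases Sym2.eq_iff.1 h with ⟨rfl, rfl⟩ | ⟨rfl, rfl⟩
    · rfl
    · exact absurd hp.1.1 hq.1.2.1
  have h3 : G.cutSize X = A.card := rfl
  rw [h3, h1]
  refine (Finset.card_union_le _ _).trans (Nat.add_le_add (le_of_eq ?_) h2)
  simp only [cutSize]
  congr!

lemma cutSize_compl [DecidableEq W] (G : SimpleGraph W) (X : Finset W) : G.cutSize Xᶜ = G.cutSize X := by
  refine Finset.card_equiv (Equiv.prodComm W W) fun p => ?_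
  simp [G.adj_comm p.1 p.2]
  tauto

open Classical in
lemma cutSize_singleton (G : SimpleGraph W) (u : W) :
    G.cutSize {u} = (G.neighborSet u).ncard := by
  have : G.neighborSet u = ((univ.filter fun w => G.Adj u w : Finset W) : Set W) := by
    ext; simp
  rw [this, Set.ncard_coe_finset, cutSize]
  refine (Finset.card_bij (fun w _ => (u, w)) ?_ ?_ ?_).symm
  · intro w hw
    have hw' : G.Adj u w := by simpa using hw
    simp [hw', hw'.ne.symm]
  · intro a _ b _ h
    exact (Prod.ext_iff.1 h).2
  · rintro ⟨a, b⟩ h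
    simp only [mem_filter, mem_univ, true_and, mem_singleton] at h
    obtain ⟨rfl, -, h⟩ := h
    exact ⟨b, by simpa using h, rfl⟩

end Cuts

/-! ### Cuts of the line graph and fault tolerance -/

section LineGraph

open Finset

variable {V : Type*}

lemma lineGraph_adj_mk {Q : SimpleGraph V} {a b c : V} (hab : Q.Adj a b) (hac : Q.Adj a c)
    (hbc : b ≠ c) : Q.lineGraph.Adj ⟨s(a, b), hab⟩ ⟨s(a, c), hac⟩ := by
  rw [lineGraph_adj_iff_exists]
  exact ⟨fun h => hbc (Sym2.congr_right.1 (Subtype.ext_iff.1 h)), a, by simp, by simp⟩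

/-- Two distinct edges share at most one vertex, so a mixed pair determines the vertex where it is
counted. -/
lemma mixedPairs_le_cutSize [Fintype V] (Q : SimpleGraph V) [Fintype Q.edgeSet]
    (X : Finset Q.edgeSet) :
    Q.mixedPairs (Subtype.val '' (X : Set Q.edgeSet)) ≤ Q.lineGraph.cutSize X := by
  classical
  set Y : Set (Sym2 V) := Subtype.val '' (X : Set Q.edgeSet) with hY
  set C := (univ : Finset (Q.edgeSet × Q.edgeSet)).filter fun p =>
    p.1 ∈ X ∧ p.2 ∉ X ∧ Q.lineGraph.Adj p.1 p.2
  have hmem : ∀ e (he : e ∈ Q.edgeSet), e ∈ Y ↔ (⟨e, he⟩ : Q.edgeSet) ∈ X := by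
    intro e he
    simp [hY, he]
  have h1 : Q.mixedPairs Y = ((univ : Finset V).sigma fun v =>
      Q.neighborsVia Y v ×ˢ Q.neighborsVia Yᶜ v).card := by
    simp [mixedPairs, Finset.card_sigma, Finset.card_product]
  have h2 : C.card = Q.lineGraph.cutSize X := by
    simp only [C, cutSize]
    congr!
  rw [h1, ← h2]
  refine le_trans (Finset.card_le_card_of_injOn
    (t := C.image (Prod.map Subtype.val Subtype.val))
    (fun p => (s(p.1, p.2.1), s(p.1, p.2.2))) ?_ ?_) Finset.card_image_le
  · rintro ⟨v, w, w'⟩ hp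
    simp only [coe_sigma, Set.mem_sigma_iff, mem_coe, mem_univ, true_and, mem_product,
      mem_neighborsVia] at hp
    obtain ⟨⟨hw, hwY⟩, hw', hwY'⟩ := hp
    rw [mem_coe, mem_image]
    refine ⟨(⟨s(v, w), hw⟩, ⟨s(v, w'), hw'⟩), ?_, rfl⟩
    simp only [C, mem_filter, mem_univ, true_and]
    refine ⟨(hmem _ _).1 hwY, fun h => hwY' ((hmem _ _).2 h), lineGraph_adj_mk hw hw' ?_⟩
    rintro rfl
    exact hwY' hwY
  · rintro ⟨v, w, w'⟩ hp ⟨x, y, y'⟩ hq h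
    simp only [coe_sigma, Set.mem_sigma_iff, mem_coe, mem_univ, true_and, mem_product,
      mem_neighborsVia] at hp hq
    simp only [Prod.mk.injEq, Sym2.eq_iff] at h
    obtain ⟨h, h'⟩ := h
    have hyy : y ≠ y' := by rintro rfl; exact hq.2.2 hq.1.2
    rcases h with ⟨rfl, rfl⟩ | ⟨rfl, rfl⟩
    · rcases h' with ⟨-, rfl⟩ | ⟨rfl, rfl⟩
      · rfl
      · exact absurd rfl hp.2.1.ne
    · rcases h' with ⟨rfl, -⟩ | ⟨rfl, rfl⟩
      · exact absurd rfl hp.1.1.ne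
      · exact absurd rfl hyy

/-- Each end of `ab` lies on `n - 1` other edges, and no edge other than `ab` contains both ends. -/
lemma IsNetwork.ncard_neighborSet_lineGraph {n : ℕ} {Q : SimpleGraph V} (hQ : Q.IsNetwork n)
    (e : Q.edgeSet) : (Q.lineGraph.neighborSet e).ncard = 2 * n - 2 := by
  have := hQ.finite
  obtain ⟨e, he⟩ := e
  induction e with | _ a b
  have hab : Q.Adj a b := he
  rw [← Set.ncard_image_of_injective _ (Subtype.val_injective)]
  have himg : Subtype.val '' Q.lineGraph.neighborSet ⟨s(a, b), he⟩ =
      (fun c => s(a, c)) '' (Q.neighborSet a \ {b}) ∪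
      (fun c => s(b, c)) '' (Q.neighborSet b \ {a}) := by
    ext f
    constructor
    · rintro ⟨⟨f, hf⟩, hadj, rfl⟩
      rw [mem_neighborSet, lineGraph_adj_iff_exists] at hadj
      obtain ⟨hne, v, hv, hv'⟩ := hadj
      obtain ⟨w, rfl⟩ := hv'
      have hvw : Q.Adj v w := hf
      rcases Sym2.mem_iff.1 hv with rfl | rfl
      · refine Or.inl ⟨w, ⟨hvw, ?_⟩, rfl⟩
        rintro rfl
        exact hne rfl
      · refine Or.inr ⟨w, ⟨hvw, ?_⟩, rfl⟩
        rintro rfl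
        exact hne (Subtype.ext Sym2.eq_swap)
    · rintro (⟨c, ⟨hc, hcb⟩, rfl⟩ | ⟨c, ⟨hc, hca⟩, rfl⟩)
      · exact ⟨⟨s(a, c), hc⟩, lineGraph_adj_mk hab hc (Ne.symm hcb), rfl⟩
      · refine ⟨⟨s(b, c), hc⟩, ?_, rfl⟩
        have := lineGraph_adj_mk hab.symm hc (Ne.symm hca)
        simpa [Sym2.eq_swap (a := a) (b := b)] using this
  rw [himg, Set.ncard_union_eq, Set.ncard_image_of_injective, Set.ncard_image_of_injective,
    Set.ncard_sdiff_singleton_of_mem (show b ∈ Q.neighborSet a from hab),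
    Set.ncard_sdiff_singleton_of_mem (show a ∈ Q.neighborSet b from hab.symm),
    hQ.degree, hQ.degree]
  · omega
  · exact fun c d h => Sym2.congr_right.1 h
  · exact fun c d h => Sym2.congr_right.1 h
  · rw [Set.disjoint_left]
    rintro _ ⟨c, ⟨-, hcb⟩, rfl⟩ ⟨d, ⟨-, hda⟩, h⟩
    rcases Sym2.eq_iff.1 h with ⟨h1, -⟩ | ⟨h1, -⟩
    · exact hab.ne h1.symm
    · exact hcb h1.symm

lemma IsNetwork.exists_adj {n : ℕ} {Q : SimpleGraph V} (hQ : Q.IsNetwork n) (a : V) :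
    ∃ b, Q.Adj a b := by
  have h : (Q.neighborSet a).Nonempty := Set.nonempty_of_ncard_ne_zero (by
    rw [hQ.degree]; exact hQ.pos.ne')
  exact h

lemma IsNetwork.exists_adj_ne {n : ℕ} (hn : 2 ≤ n) {Q : SimpleGraph V} (hQ : Q.IsNetwork n)
    (a b : V) : ∃ c, Q.Adj a c ∧ c ≠ b := by
  have := hQ.finite
  exact Set.exists_ne_of_one_lt_ncard (s := Q.neighborSet a) (by rw [hQ.degree]; omega) b

lemma IsNetwork.nonempty {n : ℕ} {Q : SimpleGraph V} (hQ : Q.IsNetwork n) : Nonempty V := by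
  by_contra h
  rw [not_nonempty_iff] at h
  have := hQ.card
  simp only [Nat.card_of_isEmpty] at this
  exact absurd this (by positivity : 0 < 2 ^ n).ne

lemma IsNetwork.le_cutSize_lineGraph [Fintype V] {n : ℕ} {Q : SimpleGraph V} (hQ : Q.IsNetwork n)
    [Fintype Q.edgeSet] (X : Finset Q.edgeSet) {e e' f f' : Q.edgeSet} (he : e ∈ X) (he' : e' ∈ X)
    (hee : e ≠ e') (hf : f ∉ X) (hf' : f' ∉ X) (hff : f ≠ f') :
    4 * n ≤ Q.lineGraph.cutSize X + 6 := by
  have h1 := hQ.le_mixedPairs (X := Subtype.val '' (X : Set Q.edgeSet)) e.2 e'.2 f.2 f'.2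
    (by simpa using he) (by simpa using he') (by simpa using hf) (by simpa using hf')
    (fun h => hee (Subtype.ext h)) (fun h => hff (Subtype.ext h))
  exact h1.trans (Nat.add_le_add_right (mixedPairs_le_cutSize Q X) 6)

/-- The bound is `(4n-6) - (2n-4) = 2n-2`; it can fail only when one side is a single vertex. -/
lemma IsNetwork.le_cutSize_deleteEdges [Fintype V] {n : ℕ} {Q : SimpleGraph V} (hn : 2 ≤ n)
    (hQ : Q.IsNetwork n) [Fintype Q.edgeSet] [DecidableEq Q.edgeSet]
    (F : Finset (Sym2 Q.edgeSet))
    (hF : F.card ≤ 2 * n - 4) {u v : Q.edgeSet} (X : Finset Q.edgeSet) (hu : u ∈ X) (hv : v ∉ X) :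
    2 * n - 2 ≤ (Q.lineGraph.deleteEdges (F : Set (Sym2 Q.edgeSet))).cutSize X ∨ X = {u} ∨
      X = ({v} : Finset Q.edgeSet)ᶜ := by
  by_cases h1 : ∃ u' ∈ X, u ≠ u'
  · by_cases h2 : ∃ v', v' ∉ X ∧ v ≠ v'
    · obtain ⟨u', hu', huu⟩ := h1
      obtain ⟨v', hv', hvv⟩ := h2
      have h3 := hQ.le_cutSize_lineGraph X hu hu' huu hv hv' hvv
      have h4 := Q.lineGraph.cutSize_le_deleteEdges_add F X
      left
      omega
    · push Not at h2
      right; right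
      ext w
      rw [mem_compl, mem_singleton]
      refine ⟨fun hw hwv => hv (hwv ▸ hw), fun hw => ?_⟩
      by_contra hwX
      exact hw (h2 w hwX).symm
  · push Not at h1
    right; left
    exact Finset.eq_singleton_iff_unique_mem.2 ⟨hu, fun w hw => (h1 w hw).symm⟩

/-- The line graph of a network stays strongly Menger edge connected after the deletion of at most
`2 * n - 4` edges. -/
theorem IsNetwork.edgeFaultTolerantSMEC_lineGraph {n : ℕ} (hn : 2 ≤ n) {Q : SimpleGraph V}
    (hQ : Q.IsNetwork n) : EdgeFaultTolerantSMEC (2 * n - 4) Q.lineGraph := by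
  classical
  intro F _ hF
  have := hQ.finite
  have := Fintype.ofFinite V
  have := Fintype.ofFinite Q.edgeSet
  set G := Q.lineGraph.deleteEdges (F : Set (Sym2 Q.edgeSet)) with hG
  -- `(2n-2) - (2n-4) = 2`; positivity is what connectedness needs.
  have hdeg_ge : ∀ u, 2 ≤ (G.neighborSet u).ncard := by
    intro u
    have h1 := Q.lineGraph.cutSize_le_deleteEdges_add F {u}
    rw [cutSize_singleton, cutSize_singleton, hQ.ncard_neighborSet_lineGraph, ← hG] at h1
    omega
  have hdeg_le : ∀ u, (G.neighborSet u).ncard ≤ 2 * n - 2 := by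
    intro u
    rw [← hQ.ncard_neighborSet_lineGraph u]
    exact Set.ncard_le_ncard (fun w (hw : G.Adj u w) => deleteEdges_le _ hw) (Set.toFinite _)
  have hcut : ∀ (X : Finset Q.edgeSet) (u v : Q.edgeSet), u ∈ X → v ∉ X →
      min (G.neighborSet u).ncard (G.neighborSet v).ncard ≤ G.cutSize X := by
    intro X u v hu hv
    rcases hQ.le_cutSize_deleteEdges hn F hF X hu hv with h | rfl | rfl
    · exact (min_le_left _ _).trans ((hdeg_le u).trans h)
    · rw [cutSize_singleton]
      exact min_le_left _ _
    · rw [cutSize_compl, cutSize_singleton]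
      exact min_le_right _ _
  have : Nonempty Q.edgeSet := by
    obtain ⟨a⟩ := hQ.nonempty
    obtain ⟨b, hab⟩ := hQ.exists_adj a
    exact ⟨⟨s(a, b), hab⟩⟩
  exact ⟨⟨preconnected_of_cutSize_pos fun X u v hu hv =>
    (lt_min (two_pos.trans_le (hdeg_ge u)) (two_pos.trans_le (hdeg_ge v))).trans_le
      (hcut X u v hu hv)⟩, fun u v _ => hasEdgeDisjointPaths_of_le_cutSize fun X => hcut X u v⟩

end LineGraph

/-! ### Optimality of the number of faults -/

section Sharpness

/-- If every neighbour of `y` other than `x` is cut off, then paths from `x` do not start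
with `y`, so that there are fewer edge-disjoint ones than the degree of `x`. -/
lemma not_hasEdgeDisjointPaths_of_pendant {W : Type*} [Finite W] {G : SimpleGraph W} {x y w : W}
    (hxy : G.Adj x y) (hy : ∀ z, G.Adj y z → z = x) (hwx : x ≠ w) (hwy : w ≠ y) :
    ¬ G.HasEdgeDisjointPaths (G.neighborSet x).ncard x w := by
  rintro ⟨P, hP⟩
  have first : ∀ i, ∃ z, G.Adj x z ∧ z ≠ y ∧ s(x, z) ∈ (P i : G.Walk x w).edges := by
    intro i
    obtain ⟨p, hp⟩ := P i
    cases p with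
    | nil => exact absurd rfl hwx
    | @cons _ z _ hxz p =>
      refine ⟨z, hxz, ?_, by simp⟩
      rintro rfl
      rw [Walk.cons_isPath_iff] at hp
      cases p with
      | nil => exact hwy rfl
      | cons hzt p =>
        obtain rfl := hy _ hzt
        exact hp.2 (by simp)
  choose z hz hzy hzP using first
  have hinj : Function.Injective z := by
    intro i j hij
    by_contra hne
    exact hP i j hne (hzP i) (hij ▸ hzP j)
  have h1 : (Set.range z).ncard = (G.neighborSet x).ncard := by
    rw [← Set.image_univ, Set.ncard_image_of_injective _ hinj, Set.ncard_univ, Nat.card_fin]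
  have h2 : Set.range z ⊆ G.neighborSet x \ {y} := by
    rintro _ ⟨i, rfl⟩
    exact ⟨hz i, hzy i⟩
  have h3 := Set.ncard_le_ncard h2 (Set.toFinite _)
  have h4 := Set.ncard_sdiff_singleton_add_one (s := G.neighborSet x) (a := y) hxy
  omega

/-- On a path `b, a, c, d` in `Q`, take `y = ab`, `x = ac`, `w = cd` and delete all edges at `y`
except `xy`. Then `x` and `w` keep degree `2n-2`, but the edge `xy` is useless for reaching `w`. -/
theorem IsNetwork.not_edgeFaultTolerantSMEC_lineGraph {V : Type*} {n k : ℕ} (hn : 2 ≤ n)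
    {Q : SimpleGraph V} (hQ : Q.IsNetwork n) (hk : 2 * n - 4 < k) :
    ¬ EdgeFaultTolerantSMEC k Q.lineGraph := by
  classical
  intro h
  have := hQ.finite
  have := Fintype.ofFinite V
  obtain ⟨a⟩ := hQ.nonempty
  obtain ⟨b, hab⟩ := hQ.exists_adj a
  obtain ⟨c, hac, hcb⟩ := hQ.exists_adj_ne hn a b
  obtain ⟨d, hcd, hda⟩ := hQ.exists_adj_ne hn c a
  -- Otherwise `w` would be adjacent to `y` and lose an edge.
  have hdb : d ≠ b := by
    rintro rfl
    exact hQ.triangleFree a c d hac hcd hab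
  set x : Q.edgeSet := ⟨s(a, c), hac⟩ with hx
  set y : Q.edgeSet := ⟨s(a, b), hab⟩ with hy
  set w : Q.edgeSet := ⟨s(c, d), hcd⟩ with hw
  have hyx : Q.lineGraph.Adj y x := lineGraph_adj_mk hab hac (Ne.symm hcb)
  have hxw : x ≠ w := by
    intro h
    have := congrArg Subtype.val h
    simp only [hx, hw, Sym2.eq_iff] at this
    rcases this with ⟨h1, -⟩ | ⟨h1, -⟩
    · exact hac.ne h1
    · exact hda h1.symm
  have hyw : ¬ Q.lineGraph.Adj y w := by
    rw [lineGraph_adj_iff_exists]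
    rintro ⟨-, v, hv, hv'⟩
    simp only [hy, hw, Sym2.mem_iff] at hv hv'
    rcases hv with rfl | rfl <;> rcases hv' with h1 | h1
    · exact hac.ne h1
    · exact hda h1.symm
    · exact hcb h1.symm
    · exact hdb h1.symm
  have hwy : w ≠ y := by
    intro h
    have := congrArg Subtype.val h
    simp only [hy, hw, Sym2.eq_iff] at this
    rcases this with ⟨h1, -⟩ | ⟨h1, -⟩
    · exact hac.ne h1.symm
    · exact hcb h1
  obtain ⟨T, hT⟩ : ∃ T : Finset Q.edgeSet, T = (Q.lineGraph.neighborSet y \ {x}).toFinset :=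
    ⟨_, rfl⟩
  have hTmem : ∀ z, z ∈ T ↔ Q.lineGraph.Adj y z ∧ z ≠ x := by
    intro z
    simp [hT]
  -- Hence `2n-3` faults, the least number exceeding `2n-4`.
  have hTcard : T.card + 1 = 2 * n - 2 := by
    rw [hT, ← Set.ncard_eq_toFinset_card', Set.ncard_sdiff_singleton_add_one (show x ∈ Q.lineGraph.neighborSet y from hyx),
      hQ.ncard_neighborSet_lineGraph]
  obtain ⟨F, hF⟩ : ∃ F : Finset (Sym2 Q.edgeSet), F = T.image fun z => s(y, z) := ⟨_, rfl⟩
  have hFmem : ∀ p q, s(p, q) ∈ F ↔ (p = y ∧ q ∈ T) ∨ (q = y ∧ p ∈ T) := by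
    intro p q
    simp only [hF, Finset.mem_image, Sym2.eq_iff]
    constructor
    · rintro ⟨z, hz, ⟨rfl, rfl⟩ | ⟨rfl, rfl⟩⟩
      · exact Or.inl ⟨rfl, hz⟩
      · exact Or.inr ⟨rfl, hz⟩
    · rintro (⟨rfl, h⟩ | ⟨rfl, h⟩)
      · exact ⟨q, h, Or.inl ⟨rfl, rfl⟩⟩
      · exact ⟨p, h, Or.inr ⟨rfl, rfl⟩⟩
  have hFsub : (F : Set (Sym2 Q.edgeSet)) ⊆ Q.lineGraph.edgeSet := by
    intro e he
    induction e with | _ p q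
    rcases (hFmem p q).1 he with ⟨rfl, h1⟩ | ⟨rfl, h1⟩
    · exact ((hTmem q).1 h1).1
    · exact ((hTmem p).1 h1).1.symm
  have hFcard : F.card ≤ k := by
    have : F.card ≤ T.card := hF ▸ Finset.card_image_le
    omega
  obtain ⟨G, hG⟩ : ∃ G, G = Q.lineGraph.deleteEdges (F : Set (Sym2 Q.edgeSet)) := ⟨_, rfl⟩
  have hGadj : ∀ p q, G.Adj p q ↔ Q.lineGraph.Adj p q ∧ s(p, q) ∉ F := by
    intro p q
    simp [hG]
  have hdeg : ∀ p, p ∉ T → p ≠ y → (G.neighborSet p).ncard = 2 * n - 2 := by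
    intro p hp hpy
    rw [← hQ.ncard_neighborSet_lineGraph p]
    congr 1
    ext q
    rw [mem_neighborSet, mem_neighborSet, hGadj, hFmem]
    refine and_iff_left_of_imp fun _ => ?_
    rintro (⟨h1, -⟩ | ⟨-, h1⟩)
    · exact hpy h1
    · exact hp h1
  have hxT : x ∉ T := by simp [hTmem]
  have hwT : w ∉ T := by simp [hTmem, hyw]
  have hpaths := (h F hFsub hFcard).2 x w hxw
  rw [← hG, hdeg x hxT hyx.ne.symm, hdeg w hwT hwy, min_self, ← hdeg x hxT hyx.ne.symm] at hpaths
  refine not_hasEdgeDisjointPaths_of_pendant (y := y) ?_ ?_ hxw hwy hpaths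
  · rw [hGadj, hFmem]
    refine ⟨hyx.symm, ?_⟩
    rintro (⟨h1, -⟩ | ⟨-, h1⟩)
    · exact hyx.ne h1.symm
    · exact hxT h1
  · intro z hz
    rw [hGadj, hFmem, hTmem] at hz
    by_contra hzx
    exact hz.2 (Or.inl ⟨rfl, hz.1, hzx⟩)

end Sharpness
end SimpleGraph

theorem theorem3p3 {V : Type*} (n : ℕ) (hn : 2 ≤ n) (Q : SimpleGraph V)
    (hQ : SimpleGraph.IsHypercubeLike n Q) :
    SimpleGraph.EdgeFaultTolerantSMEC (2 * n - 4) Q.lineGraph ∧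
      ∀ k : ℕ, 2 * n - 4 < k → ¬ SimpleGraph.EdgeFaultTolerantSMEC k Q.lineGraph :=
  ⟨hQ.isNetwork.edgeFaultTolerantSMEC_lineGraph hn,
    fun _ hk => hQ.isNetwork.not_edgeFaultTolerantSMEC_lineGraph hn hk⟩
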